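/- There is an absolute constant $C>0$ such that the following holds. Let $\Sigma$ be an alphabet, let $1\le k\le m$ be integers, let $\varepsilon>0$ and $0<\beta<1$, and let $P\in\Sigma^m$ be a pattern. Write $\mathrm{dist}_H$ for the Hamming distance and $Q^\infty[0,m-1]$ for the length-$m$ prefix of the infinite repetition of a nonempty string $Q$. For a string $S\in\Sigma^n$ with $n\ge m$ and a real number $x$, let $c_x(S)$ be the number of positions $i\in\{0,\dots,n-m\}$ with $\mathrm{dist}_H(P,S[i,i+m-1])\le x$. Suppose that there is no nonempty string $Q$ over $\Sigma$ with $|Q|\le \frac{m}{128k}$ and $\mathrm{dist}_H(Q^\infty[0,m-1],P)\le 2k$. Then there is a randomized algorithm $\mathrm{Alg}$ that takes a string over $\Sigma$ and a pattern in $\Sigma^m$ and outputs a count $c\in\mathbb{N}$ and, optionally, a position, such that: 1. $\mathrm{Alg}$ is $\varepsilon$-differentially private: for all patterns $P'\in\Sigma^m$, all strings $S,S'$ of equal length that differ in exactly one position, and all sets $\mathrm{Out}$ of outputs, $\Pr(\mathrm{Alg}(S,P')\in \mathrm{Out})\le e^{\varepsilon}\Pr(\mathrm{Alg}(S',P')\in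 \mathrm{Out})$. 2. For every $n\ge m$ and every $S\in\Sigma^n$, with $\gamma=C\,\varepsilon^{-1}(\ln n+\ln(1/\beta))$, with probability at least $1-\beta$ the output of $\mathrm{Alg}(S,P)$ satisfies $c_k(S)\le c\le c_{(1+\gamma)k}(S)$ and, if $c>0$, the output also contains a witness, i.e. a position $i\in\{0,\dots,n-m\}$ with $\mathrm{dist}_H(P,S[i,i+m-1])\le(1+\gamma)k$. Here a randomized algorithm is an arbitrary assignment of an output distribution to each input. -/

import Mathlib

/-- The substring `S[i, i + m - 1]` of length `m` of a string `S` of length `n`. Strings of length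
`n` over the alphabet `α` are functions `Fin n → α`, indexed from `0`. -/
def substringAt {α : Type*} {n m : ℕ} (S : Fin n → α) (i : ℕ) (h : i + m ≤ n) : Fin m → α :=
  fun j => S ⟨i + j, by omega⟩

/-- The position `i` of `S` satisfies `i ∈ [0, n - m]` and the substring `S[i, i + m - 1]`
has Hamming distance at most `x` from `P`. -/
def IsMismatchOccurrence {α : Type*} [DecidableEq α] {n m : ℕ}
    (S : Fin n → α) (P : Fin m → α) (x : ℝ) (i : ℕ) : Prop :=
  ∃ h : i + m ≤ n, (hammingDist (substringAt S i h) P : ℝ) ≤ x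

/-- `c_x(S, P)`: the number of positions `i` of `S` with `dist_H (S[i, i + m - 1], P) ≤ x`. -/
noncomputable def occurrenceCount {α : Type*} [DecidableEq α] {n m : ℕ}
    (S : Fin n → α) (P : Fin m → α) (x : ℝ) : ℕ :=
  Set.ncard {i : ℕ | IsMismatchOccurrence S P x i}

/-- `Q^∞[0, m - 1]`: the prefix of length `m` of the infinite repetition of a nonempty
string `Q` of length `q`. -/
def periodicPrefix {α : Type*} {q : ℕ} (Q : Fin q → α) (hq : 0 < q) (m : ℕ) : Fin m → α :=
  fun j => Q ⟨j % q, Nat.mod_lt j hq⟩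

/-- Two strings of the same length are neighbouring if they differ in exactly one position. -/
def Neighbouring {α : Type*} [DecidableEq α] {n : ℕ} (S S' : Fin n → α) : Prop :=
  hammingDist S S' = 1

/-- A randomized pattern matching algorithm `Σ^* × Σ^m → R` with countably many possible outputs,
given by its output distribution on every text (of any length `n`) and every pattern of
length `m`. -/
abbrev PatternMatchingAlgorithm (α : Type*) (m : ℕ) (R : Type*) :=
  (n : ℕ) → (Fin n → α) → (Fin m → α) → PMF R

/-- `ε`-differential privacy of a pattern matching algorithm: only the text is private.
For a `PMF`, `toOuterMeasure Out` is the probability of the event `Out`. -/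
def PatternMatchingAlgorithm.IsDifferentiallyPrivate {α : Type*} [DecidableEq α] {m : ℕ}
    {R : Type*} (ε : ℝ) (Alg : PatternMatchingAlgorithm α m R) : Prop :=
  ∀ (Out : Set R) (P : Fin m → α) (n : ℕ) (S S' : Fin n → α), Neighbouring S S' →
    (Alg n S P).toOuterMeasure Out ≤
      ENNReal.ofReal (Real.exp ε) * (Alg n S' P).toOuterMeasure Out

/-- The output `(c, w)` of a counting algorithm (a count `c` and an optional position `w`) solves
the counting problem for `S` and `P` with threshold `k` and multiplicative error `γ`:
`c_k(S) ≤ c ≤ c_{(1 + γ) k}(S)` and, if `c > 0`, a witness is returned. -/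
def IsCorrectCount {α : Type*} [DecidableEq α] {n m : ℕ} (S : Fin n → α) (P : Fin m → α)
    (k : ℕ) (γ : ℝ) (out : ℕ × Option ℕ) : Prop :=
  occurrenceCount S P k ≤ out.1 ∧
  out.1 ≤ occurrenceCount S P ((1 + γ) * k) ∧
  (0 < out.1 → ∃ i : ℕ, out.2 = some i ∧ IsMismatchOccurrence S P ((1 + γ) * k) i)

/-!
Changing one letter of the text changes every distance `dist_H (P, S[i, i + m - 1])` by at most one.
Hence, writing `c_x(S)` for the number of occurrences with at most `x` mismatches,
`c_x(S) ≤ c_{x+1}(S')` for neighbouring texts `S`, `S'`. Fix a centre `y` and let the *loss* of an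
output `(c, w)` be the least `t` such that `c_{y-t}(S) ≤ c ≤ c_{y+t}(S)` and, if `c > 0`, the
position `w` is an occurrence with at most `y + t` mismatches. By the previous remark the loss has
sensitivity one (`matchingLoss_le_add_one`), so the exponential mechanism that selects an output
with probability proportional to `exp (-ε/2 * loss)` is `ε`-differentially private
(`exponentialMechanism_le_of_loss_close`).

With `N ≤ n` possible positions there are at most `1 + N ^ 2` outputs to choose from: `(0, none)` and
the pairs of a positive count and a position. The output consisting of `c_y(S)` and any occurrence
has loss zero, so the probability of a loss above `T` is at most `N ^ 2 * exp (-ε/2 * T)`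
(`exponentialMechanism_toOuterMeasure_ge`). Taking `y = (1 + γ/2) k` and `T = γ k / 2`, a loss of at
most `T` is exactly correctness with threshold `k` and error `γ`, and for
`γ = 8 ε⁻¹ (ln n + ln (1/β))` the failure probability is at most `β`, because `k ≥ 1`.

The multiplicative count error is obtained by shifting the mismatch threshold instead of perturbing
the count, so no bound on the number of occurrences covering a position enters the argument.
-/

open scoped ENNReal

/-! ### The exponential mechanism -/

/-- Normalising two weight functions that agree up to a factor `a` gives distributions that agree up
to a factor `a * a`: one factor for the weights and one for the normalising constants. -/
theorem toOuterMeasure_normalize_le {Ω : Type*} {f g : Ω → ℝ≥0∞} {a : ℝ≥0∞}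
    (ha0 : a ≠ 0) (ha : a ≠ ∞) (hf0 : tsum f ≠ 0) (hf : tsum f ≠ ∞) (hg0 : tsum g ≠ 0)
    (hg : tsum g ≠ ∞) (hfg : ∀ o, f o ≤ a * g o) (hgf : ∀ o, g o ≤ a * f o) (Out : Set Ω) :
    (PMF.normalize f hf0 hf).toOuterMeasure Out ≤
      a * a * (PMF.normalize g hg0 hg).toOuterMeasure Out := by
  have hsum : tsum g ≤ a * tsum f := by
    rw [← ENNReal.tsum_mul_left]
    exact ENNReal.tsum_le_tsum hgf
  have hinv : (tsum f)⁻¹ ≤ a * (tsum g)⁻¹ := by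
    have h := ENNReal.inv_le_inv.2 hsum
    rw [ENNReal.mul_inv (Or.inl ha0) (Or.inl ha)] at h
    calc (tsum f)⁻¹ = a * (a⁻¹ * (tsum f)⁻¹) := by
          rw [← mul_assoc, ENNReal.mul_inv_cancel ha0 ha, one_mul]
      _ ≤ a * (tsum g)⁻¹ := by gcongr
  rw [PMF.toOuterMeasure_apply, PMF.toOuterMeasure_apply, ← ENNReal.tsum_mul_left]
  refine ENNReal.tsum_le_tsum fun o => ?_
  by_cases ho : o ∈ Out
  · simp only [Set.indicator_of_mem ho, PMF.normalize_apply]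
    calc f o * (tsum f)⁻¹ ≤ (a * g o) * (a * (tsum g)⁻¹) := mul_le_mul' (hfg o) hinv
      _ = a * a * (g o * (tsum g)⁻¹) := by ring
  · simp [Set.indicator_of_notMem ho]

/-- The unnormalised weight `exp (-ε/2 * loss o)` of the exponential mechanism on the finite set `R`
of possible outputs; it vanishes outside `R`. -/
noncomputable def exponentialWeight {Ω : Type*} [DecidableEq Ω] (ε : ℝ) (R : Finset Ω)
    (loss : Ω → ℕ) (o : Ω) : ℝ≥0∞ :=
  if o ∈ R then ENNReal.ofReal (Real.exp (-(ε / 2) * loss o)) else 0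

section ExponentialMechanism

variable {Ω : Type*} [DecidableEq Ω] {ε : ℝ} {R : Finset Ω} {loss loss' : Ω → ℕ}

theorem tsum_exponentialWeight :
    ∑' o, exponentialWeight ε R loss o = ∑ o ∈ R, exponentialWeight ε R loss o :=
  tsum_eq_sum fun o ho => by simp [exponentialWeight, ho]

theorem tsum_exponentialWeight_ne_zero (hR : R.Nonempty) :
    tsum (exponentialWeight ε R loss) ≠ 0 := by
  obtain ⟨o, ho⟩ := hR
  intro h
  have := ENNReal.tsum_eq_zero.1 h o
  simp [exponentialWeight, ho] at this
  exact absurd this (not_le.2 (Real.exp_pos _))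

theorem tsum_exponentialWeight_ne_top : tsum (exponentialWeight ε R loss) ≠ ∞ := by
  rw [tsum_exponentialWeight]
  refine (ENNReal.sum_lt_top.2 fun o ho => ?_).ne
  simp [exponentialWeight, ho]

/-- The exponential mechanism: it selects `o ∈ R` with probability proportional to
`exp (-ε/2 * loss o)`. -/
noncomputable def exponentialMechanism (ε : ℝ) (R : Finset Ω) (hR : R.Nonempty)
    (loss : Ω → ℕ) : PMF Ω :=
  PMF.normalize (exponentialWeight ε R loss) (tsum_exponentialWeight_ne_zero hR)
    tsum_exponentialWeight_ne_top

theorem exponentialWeight_le (hε : 0 ≤ ε) (h : ∀ o ∈ R, loss' o ≤ loss o + 1) (o : Ω) :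
    exponentialWeight ε R loss o ≤
      ENNReal.ofReal (Real.exp (ε / 2)) * exponentialWeight ε R loss' o := by
  by_cases ho : o ∈ R
  · simp only [exponentialWeight, ho, if_true]
    rw [← ENNReal.ofReal_mul (Real.exp_pos _).le, ← Real.exp_add]
    refine ENNReal.ofReal_le_ofReal (Real.exp_le_exp.2 ?_)
    have h' : (loss' o : ℝ) ≤ loss o + 1 := by exact_mod_cast h o ho
    nlinarith
  · simp [exponentialWeight, ho]

/-- Privacy of the exponential mechanism for a loss of sensitivity one. -/
theorem exponentialMechanism_le_of_loss_close (hε : 0 ≤ ε) (hR : R.Nonempty)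
    (h : ∀ o ∈ R, loss' o ≤ loss o + 1) (h' : ∀ o ∈ R, loss o ≤ loss' o + 1) (Out : Set Ω) :
    (exponentialMechanism ε R hR loss).toOuterMeasure Out ≤
      ENNReal.ofReal (Real.exp ε) * (exponentialMechanism ε R hR loss').toOuterMeasure Out := by
  have hexp : ENNReal.ofReal (Real.exp ε) =
      ENNReal.ofReal (Real.exp (ε / 2)) * ENNReal.ofReal (Real.exp (ε / 2)) := by
    rw [← ENNReal.ofReal_mul (Real.exp_pos _).le, ← Real.exp_add, add_halves]
  rw [hexp]
  exact toOuterMeasure_normalize_le (ENNReal.ofReal_pos.2 (Real.exp_pos _)).ne'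
    ENNReal.ofReal_ne_top _ _ _ _ (exponentialWeight_le hε h) (exponentialWeight_le hε h') Out

/-- Utility of the exponential mechanism: if some output `o₀` has loss zero, then a loss above `T`
occurs with probability at most `b`, provided that the outputs other than `o₀` number at most
`b * exp (ε/2 * T)`. Not counting `o₀` itself matters when `R` has only two elements. -/
theorem exponentialMechanism_toOuterMeasure_ge (hε : 0 ≤ ε) (hR : R.Nonempty) {o₀ : Ω}
    (ho₀ : o₀ ∈ R) (hloss : loss o₀ = 0) {T b : ℝ} (hT : 0 ≤ T) (hb : 0 ≤ b)
    (hcard : ((R.erase o₀).card : ℝ) * Real.exp (-(ε / 2) * T) ≤ b) {G : Set Ω}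
    (hG : ∀ o ∈ R, (loss o : ℝ) ≤ T → o ∈ G) :
    ENNReal.ofReal (1 - b) ≤ (exponentialMechanism ε R hR loss).toOuterMeasure G := by
  set p := exponentialMechanism ε R hR loss with hp
  have hbad : p.toOuterMeasure Gᶜ ≤ ENNReal.ofReal b := by
    have hZ : (tsum (exponentialWeight ε R loss))⁻¹ ≤ 1 := by
      rw [ENNReal.inv_le_one]
      refine le_trans ?_ (ENNReal.le_tsum o₀)
      simp [exponentialWeight, ho₀, hloss]
    rw [PMF.toOuterMeasure_apply]
    calc ∑' o, Gᶜ.indicator p o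
        = ∑ o ∈ R.erase o₀, Gᶜ.indicator p o := by
          refine tsum_eq_sum fun o ho => ?_
          by_cases hoR : o ∈ R
          · have : o = o₀ := by simpa [hoR] using ho
            subst this
            exact Set.indicator_of_notMem (not_not.2 (hG o ho₀ (by simpa [hloss] using hT))) _
          · simp [hp, exponentialMechanism, exponentialWeight, hoR]
      _ ≤ ∑ _o ∈ R.erase o₀, ENNReal.ofReal (Real.exp (-(ε / 2) * T)) := by
          refine Finset.sum_le_sum fun o ho => ?_
          have hoR := Finset.mem_of_mem_erase ho
          by_cases hoG : o ∈ G
          · simp [hoG]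
          · rw [Set.indicator_of_mem (by exact hoG)]
            have hlt : T < loss o := not_le.1 fun h => hoG (hG o hoR h)
            calc p o ≤ exponentialWeight ε R loss o := by
                  rw [hp, exponentialMechanism, PMF.normalize_apply]
                  exact mul_le_of_le_one_right' hZ
              _ ≤ _ := by
                  simp only [exponentialWeight, hoR, if_true]
                  refine ENNReal.ofReal_le_ofReal (Real.exp_le_exp.2 ?_)
                  nlinarith
      _ ≤ ENNReal.ofReal b := by
          rw [Finset.sum_const, nsmul_eq_mul, ← ENNReal.ofReal_natCast,
            ← ENNReal.ofReal_mul (Nat.cast_nonneg _)]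
          exact ENNReal.ofReal_le_ofReal hcard
  have hone : 1 ≤ p.toOuterMeasure G + p.toOuterMeasure Gᶜ := by
    refine le_trans (le_of_eq ?_) (MeasureTheory.measure_union_le G Gᶜ)
    rw [Set.union_compl_self]
    exact ((p.toOuterMeasure_apply_eq_one_iff _).2 (Set.subset_univ _)).symm
  rw [ENNReal.ofReal_sub _ hb, ENNReal.ofReal_one]
  exact tsub_le_iff_right.2 (hone.trans (by gcongr))

end ExponentialMechanism

/-! ### Occurrences in neighbouring texts -/

section Occurrences

variable {α : Type*} [DecidableEq α] {n m : ℕ} {S S' : Fin n → α} {P : Fin m → α} {x y : ℝ} {i : ℕ}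

theorem hammingDist_substringAt_le (h : i + m ≤ n) :
    hammingDist (substringAt S i h) (substringAt S' i h) ≤ hammingDist S S' := by
  refine Finset.card_le_card_of_injOn (fun j : Fin m => (⟨i + j, by omega⟩ : Fin n)) ?_ ?_
  · intro j hj
    exact Finset.mem_filter.2 ⟨Finset.mem_univ _, (Finset.mem_filter.1 (Finset.mem_coe.1 hj)).2⟩
  · intro a _ b _ hab
    simp only [Fin.mk.injEq] at hab
    exact Fin.ext (by omega)

theorem IsMismatchOccurrence.mono (h : IsMismatchOccurrence S P x i) (hxy : x ≤ y) :
    IsMismatchOccurrence S P y i :=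
  ⟨h.1, h.2.trans hxy⟩

theorem IsMismatchOccurrence.of_neighbouring (h : IsMismatchOccurrence S P x i)
    (hS : Neighbouring S S') : IsMismatchOccurrence S' P (x + 1) i := by
  obtain ⟨hi, hx⟩ := h
  refine ⟨hi, ?_⟩
  have h1 := hammingDist_triangle (substringAt S' i hi) (substringAt S i hi) P
  have h2 := hammingDist_substringAt_le (S := S') (S' := S) hi
  rw [hammingDist_comm S' S, show hammingDist S S' = 1 from hS] at h2
  have h3 : (hammingDist (substringAt S' i hi) P : ℝ) ≤ 1 + hammingDist (substringAt S i hi) P := by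
    exact_mod_cast h1.trans (by gcongr)
  linarith

theorem setOf_isMismatchOccurrence_subset :
    {i | IsMismatchOccurrence S P x i} ⊆ (Finset.range (n + 1 - m) : Set ℕ) := by
  rintro i ⟨hi, -⟩
  simp only [Finset.coe_range, Set.mem_Iio]
  omega

theorem finite_setOf_isMismatchOccurrence : {i | IsMismatchOccurrence S P x i}.Finite :=
  (Finset.finite_toSet _).subset setOf_isMismatchOccurrence_subset

theorem occurrenceCount_le : occurrenceCount S P x ≤ n + 1 - m := by
  simpa [occurrenceCount] using Set.ncard_le_ncard (setOf_isMismatchOccurrence_subset (S := S) (P := P) (x := x))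
    (Finset.finite_toSet _)

theorem occurrenceCount_mono (hxy : x ≤ y) : occurrenceCount S P x ≤ occurrenceCount S P y :=
  Set.ncard_le_ncard (fun _ h => IsMismatchOccurrence.mono h hxy) finite_setOf_isMismatchOccurrence

theorem occurrenceCount_le_of_neighbouring (hS : Neighbouring S S') :
    occurrenceCount S P x ≤ occurrenceCount S' P (x + 1) :=
  Set.ncard_le_ncard (fun _ h => IsMismatchOccurrence.of_neighbouring h hS)
    finite_setOf_isMismatchOccurrence

theorem exists_isMismatchOccurrence_of_occurrenceCount_pos (h : 0 < occurrenceCount S P x) :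
    ∃ i, IsMismatchOccurrence S P x i :=
  Set.nonempty_of_ncard_ne_zero h.ne'

theorem occurrenceCount_eq_zero (hx : x < 0) : occurrenceCount S P x = 0 := by
  by_contra h
  obtain ⟨i, hi, hd⟩ := exists_isMismatchOccurrence_of_occurrenceCount_pos (Nat.pos_of_ne_zero h)
  exact absurd (hd.trans_lt hx) (not_lt.2 (Nat.cast_nonneg _))

theorem isMismatchOccurrence_of_length_le (hx : (m : ℝ) ≤ x) (hi : i + m ≤ n) :
    IsMismatchOccurrence S P x i := by
  refine ⟨hi, le_trans ?_ hx⟩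
  exact_mod_cast hammingDist_le_card_fintype.trans_eq (Fintype.card_fin m)

theorem occurrenceCount_eq_of_length_le (hx : (m : ℝ) ≤ x) :
    occurrenceCount S P x = n + 1 - m := by
  have : {i | IsMismatchOccurrence S P x i} = (Finset.range (n + 1 - m) : Set ℕ) := by
    refine setOf_isMismatchOccurrence_subset.antisymm fun i hi => ?_
    simp only [Finset.coe_range, Set.mem_Iio] at hi
    exact isMismatchOccurrence_of_length_le hx (by omega)
  rw [occurrenceCount, this, Set.ncard_coe_finset, Finset.card_range]

/-! ### Outputs and their loss -/

/-- The output `(c, w)` satisfies `c_{y-t}(S) ≤ c ≤ c_{y+t}(S)` and, if `c > 0`, the position `w` is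
an occurrence with at most `y + t` mismatches. -/
def IsCorrectWithin (S : Fin n → α) (P : Fin m → α) (y t : ℝ) (out : ℕ × Option ℕ) : Prop :=
  occurrenceCount S P (y - t) ≤ out.1 ∧ out.1 ≤ occurrenceCount S P (y + t) ∧
    (0 < out.1 → ∃ i : ℕ, out.2 = some i ∧ IsMismatchOccurrence S P (y + t) i)

/-- The least natural number `t` for which the output is correct within `t` of the centre `y`.
For the outputs in `matchingOutputs` such a `t` exists. -/
noncomputable def matchingLoss (S : Fin n → α) (P : Fin m → α) (y : ℝ) (out : ℕ × Option ℕ) : ℕ :=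
  sInf {t : ℕ | IsCorrectWithin S P y t out}

/-- The outputs among which a count and a witness are selected: `(0, none)`, or a positive count
together with a position. If the text is shorter than the pattern, only `(0, none)` remains. -/
def matchingOutputs (n m : ℕ) : Finset (ℕ × Option ℕ) :=
  insert (0, none) (Finset.Icc 1 (n + 1 - m) ×ˢ (Finset.range (n + 1 - m)).image some)

theorem matchingOutputs_nonempty (n m : ℕ) : (matchingOutputs n m).Nonempty :=
  Finset.insert_nonempty _ _

theorem card_matchingOutputs_le (n m : ℕ) :
    (matchingOutputs n m).card ≤ (n + 1 - m) ^ 2 + 1 := by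
  refine (Finset.card_insert_le _ _).trans ?_
  rw [Finset.card_product, Nat.card_Icc, Nat.add_sub_cancel, pow_two]
  gcongr
  exact Finset.card_image_le.trans_eq (Finset.card_range _)

theorem IsCorrectWithin.mono {s t : ℝ} {out : ℕ × Option ℕ} (h : IsCorrectWithin S P y s out)
    (hst : s ≤ t) : IsCorrectWithin S P y t out := by
  obtain ⟨h1, h2, h3⟩ := h
  refine ⟨(occurrenceCount_mono (by linarith)).trans h1,
    h2.trans (occurrenceCount_mono (by linarith)), fun hc => ?_⟩
  obtain ⟨i, hi, ho⟩ := h3 hc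
  exact ⟨i, hi, ho.mono (by linarith)⟩

theorem IsCorrectWithin.of_neighbouring {t : ℝ} {out : ℕ × Option ℕ}
    (h : IsCorrectWithin S P y t out) (hS : Neighbouring S S') :
    IsCorrectWithin S' P y (t + 1) out := by
  have hS' : Neighbouring S' S := (hammingDist_comm S' S).trans hS
  obtain ⟨h1, h2, h3⟩ := h
  refine ⟨?_, ?_, fun hc => ?_⟩
  · refine (occurrenceCount_le_of_neighbouring hS').trans (le_trans (le_of_eq ?_) h1)
    congr 1
    ring
  · rw [← add_assoc]
    exact h2.trans (occurrenceCount_le_of_neighbouring hS)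
  · obtain ⟨i, hi, ho⟩ := h3 hc
    exact ⟨i, hi, add_assoc y t 1 ▸ ho.of_neighbouring hS⟩

/-- Once `y - t < 0` and `m ≤ y + t`, the lower bound on the count is `0` and every position is an
occurrence. -/
theorem exists_isCorrectWithin {out : ℕ × Option ℕ} (hout : out ∈ matchingOutputs n m) :
    ∃ t : ℕ, IsCorrectWithin S P y t out := by
  obtain ⟨t, ht⟩ := exists_nat_gt (|y| + m)
  have hm : (0 : ℝ) ≤ m := Nat.cast_nonneg m
  have hneg : y - t < 0 := by linarith [le_abs_self y]
  have hbig : (m : ℝ) ≤ y + t := by linarith [neg_abs_le y]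
  refine ⟨t, ?_⟩
  rw [IsCorrectWithin, occurrenceCount_eq_zero hneg, occurrenceCount_eq_of_length_le hbig]
  obtain ⟨c, w⟩ := out
  simp only [matchingOutputs, Finset.mem_insert, Prod.mk.injEq, Finset.mem_product, Finset.mem_Icc,
    Finset.mem_image, Finset.mem_range] at hout
  rcases hout with ⟨rfl, rfl⟩ | ⟨⟨-, hc⟩, i, hi, rfl⟩
  · simp
  · exact ⟨Nat.zero_le _, hc, fun _ => ⟨i, rfl, isMismatchOccurrence_of_length_le hbig (by omega)⟩⟩

theorem isCorrectWithin_matchingLoss {out : ℕ × Option ℕ} (hout : out ∈ matchingOutputs n m) :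
    IsCorrectWithin S P y (matchingLoss S P y out) out :=
  Nat.sInf_mem (s := {t : ℕ | IsCorrectWithin S P y t out}) (exists_isCorrectWithin hout)

theorem matchingLoss_le_add_one (hS : Neighbouring S S') {out : ℕ × Option ℕ}
    (hout : out ∈ matchingOutputs n m) :
    matchingLoss S' P y out ≤ matchingLoss S P y out + 1 := by
  refine Nat.sInf_le ?_
  have := (isCorrectWithin_matchingLoss (S := S) (P := P) (y := y) hout).of_neighbouring hS
  simpa using this

/-- The exact count at the centre `y`, with any occurrence as the witness, has loss zero. -/
theorem exists_matchingLoss_eq_zero (S : Fin n → α) (P : Fin m → α) (y : ℝ) :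
    ∃ out ∈ matchingOutputs n m, matchingLoss S P y out = 0 := by
  suffices ∃ out ∈ matchingOutputs n m, IsCorrectWithin S P y 0 out by
    obtain ⟨out, hout, h⟩ := this
    exact ⟨out, hout, Nat.sInf_eq_zero.2 (Or.inl (by simpa using h))⟩
  rcases Nat.eq_zero_or_pos (occurrenceCount S P y) with h0 | hpos
  · exact ⟨(0, none), Finset.mem_insert_self _ _, by simp [IsCorrectWithin, h0]⟩
  · obtain ⟨i, hi⟩ := exists_isMismatchOccurrence_of_occurrenceCount_pos hpos
    refine ⟨(occurrenceCount S P y, some i), Finset.mem_insert_of_mem ?_, ?_⟩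
    · have := hi.1
      simp only [Finset.mem_product, Finset.mem_Icc, Finset.mem_image, Finset.mem_range]
      exact ⟨⟨hpos, occurrenceCount_le⟩, i, by omega, rfl⟩
    · simp [IsCorrectWithin, hi]

theorem IsCorrectWithin.isCorrectCount {k : ℕ} {γ : ℝ} {out : ℕ × Option ℕ}
    (h : IsCorrectWithin S P ((1 + γ / 2) * k) (γ / 2 * k) out) : IsCorrectCount S P k γ out := by
  have h1 : (1 + γ / 2) * k - γ / 2 * k = (k : ℝ) := by ring
  have h2 : (1 + γ / 2) * k + γ / 2 * k = (1 + γ) * (k : ℝ) := by ring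
  rwa [IsCorrectWithin, h1, h2] at h

end Occurrences

/-! ### The private counting algorithm -/

theorem mainTheorem3 :
    ∃ C : ℝ, 0 < C ∧
      ∀ (α : Type*) [DecidableEq α] (m k : ℕ) (ε β : ℝ) (P : Fin m → α),
        1 ≤ k → k ≤ m → 0 < ε → 0 < β → β < 1 →
        (¬ ∃ (q : ℕ) (hq : 0 < q) (Q : Fin q → α),
          (q : ℝ) ≤ (m : ℝ) / (128 * (k : ℝ)) ∧
            hammingDist (periodicPrefix Q hq m) P ≤ 2 * k) →
        ∃ Alg : PatternMatchingAlgorithm α m (ℕ × Option ℕ),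
          Alg.IsDifferentiallyPrivate ε ∧
          ∀ (n : ℕ) (S : Fin n → α), m ≤ n →
            ENNReal.ofReal (1 - β) ≤
              (Alg n S P).toOuterMeasure
                {out | IsCorrectCount S P k
                  (C * ε⁻¹ * (Real.log n + Real.log (1 / β))) out} := by
  refine ⟨8, by norm_num, ?_⟩
  intro α _ m k ε β P hk hkm hε hβ hβ1 _
  let γ : ℕ → ℝ := fun n => 8 * ε⁻¹ * (Real.log n + Real.log (1 / β))
  refine ⟨fun n S P' => exponentialMechanism ε (matchingOutputs n m) (matchingOutputs_nonempty n m)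
    (matchingLoss S P' ((1 + γ n / 2) * k)), ?_, ?_⟩
  · intro Out P' n S S' hS
    have hS' : Neighbouring S' S := (hammingDist_comm S' S).trans hS
    exact exponentialMechanism_le_of_loss_close hε.le _
      (fun o ho => matchingLoss_le_add_one hS ho) (fun o ho => matchingLoss_le_add_one hS' ho) Out
  · intro n S hmn
    obtain ⟨o₀, ho₀, hloss⟩ := exists_matchingLoss_eq_zero S P ((1 + γ n / 2) * k)
    have hn : (1 : ℝ) ≤ n := by exact_mod_cast hk.trans (hkm.trans hmn)
    have hk' : (1 : ℝ) ≤ k := by exact_mod_cast hk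
    have hlogn : 0 ≤ Real.log n := Real.log_nonneg hn
    have hlogβ : 0 ≤ Real.log (1 / β) := Real.log_nonneg ((one_le_div hβ).2 hβ1.le)
    have hγ : 0 ≤ γ n := by positivity
    refine exponentialMechanism_toOuterMeasure_ge hε.le _ ho₀ hloss (T := γ n / 2 * k)
      (by positivity) hβ.le ?_ fun o ho hT =>
        ((isCorrectWithin_matchingLoss ho).mono hT).isCorrectCount
    have hcard : (((matchingOutputs n m).erase o₀).card : ℝ) ≤ (n : ℝ) ^ 2 := by
      have h1 := card_matchingOutputs_le n m
      have h2 : (n + 1 - m) ^ 2 ≤ n ^ 2 := Nat.pow_le_pow_left (by omega) 2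
      rw [Finset.card_erase_of_mem ho₀]
      exact_mod_cast (by omega : (matchingOutputs n m).card - 1 ≤ n ^ 2)
    -- The exponent is `-2 k (ln n + ln (1/β)) ≤ -2 ln n + ln β`.
    have hexp : Real.exp (-(ε / 2) * (γ n / 2 * k)) ≤ β / (n : ℝ) ^ 2 := by
      rw [← Real.le_log_iff_exp_le (by positivity), Real.log_div hβ.ne' (by positivity),
        Real.log_pow]
      have hγε : -(ε / 2) * (γ n / 2 * k) = -2 * k * (Real.log n + Real.log (1 / β)) := by
        simp only [γ]
        field_simp
        ring
      have hinv : Real.log β = -Real.log (1 / β) := by simp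
      rw [hγε, hinv]
      push_cast
      nlinarith
    calc _ ≤ (n : ℝ) ^ 2 * (β / (n : ℝ) ^ 2) := by gcongr
      _ = β := by field_simp
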